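/- Let $G=(V,E,c)$ be a finite connected undirected graph (loops and parallel edges allowed) with a fixed planar embedding and edge capacities $c:E\to\mathbb{R}_{\ge 0}$. Let $G_D$ be its embedded dual graph, whose vertices are the faces of $G$, whose faces are the vertices of $G$, and in which each dual edge has length equal to the capacity of its primal edge. Let $s,t\in V$, and let $\pi$ be a simple path in $G_D$ traversing pairwise distinct dual vertices $f_1,\dots,f_k$, where $f_1$ is incident to $s$ and $f_k$ is incident to $t$. For a simple cycle $C$ in $G_D$ (possibly a loop or a pair of parallel edges), the cost $c(C)$ is the sum of the lengths of its edges, and $\mathrm{int}(C)$ is the region inside $C$, including $C$ itself; here the embedding is drawn with $t$ in the unbounded face of $G_D$, so the inside of $C$ is the side of $C$ not containing $t$. The cycle $C$ is a cut-cycle if $\mathrm{int}(C)$ contains $s$ but not $t$ (so $C$ separates $s$ from $t$, and $\mathrm{int}(C)$ is its closed side containing $s$). It is an $f_i$-cut-cycle if it is a cut-cycle that passes through $f_i$ and through no $f_j$ with $j>i$. It is a minimum $f_i$-cut-cycle if moreover its cost is minimum among all $f_i$-cut-cycles. Let $1\le i<j\le k$, let $C_i$ be a minimum $f_i$-cut-cycle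 and let $C_j$ be a minimum $f_j$-cut-cycle. Then for some $i'\le i$ there exists a minimum $f_{i'}$-cut-cycle $C_{i'}\subseteq\mathrm{int}(C_j)$ such that $c(C_{i'})\le c(C_i)$. -/

import Mathlib

/-- A connected undirected graph `G` (loops and parallel edges are allowed) with a planar embedding,
given by its rotation system on the type `D` of darts (oriented edges). `rot d` is the next dart
counterclockwise around the origin of `d`, and `rev d` is `d` with the opposite orientation. -/
structure PlaneGraph (D : Type*) where
  rot : Equiv.Perm D
  rev : Equiv.Perm D
  rev_rev : ∀ d, rev (rev d) = d
  rev_ne : ∀ d, rev d ≠ d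
  /-- The graph is connected. -/
  connected : ∀ a b : D, ∃ g ∈ Subgroup.closure {rot, rev}, g a = b
  /-- Euler's formula: the surface is the sphere. The orbits of `rot`, `rev` and `rot⁻¹ * rev` are
  the vertices, the edges and the faces. -/
  euler : Nat.card (Quotient (Equiv.Perm.SameCycle.setoid rot)) +
      Nat.card (Quotient (Equiv.Perm.SameCycle.setoid (rot⁻¹ * rev))) =
    Nat.card (Quotient (Equiv.Perm.SameCycle.setoid rev)) + 2

namespace PlaneGraph

variable {D : Type*} (G : PlaneGraph D)

/-- The next dart along the face to the left of a dart. -/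
def facePerm : Equiv.Perm D := G.rot⁻¹ * G.rev

/-- Vertices of `G`, that is, faces of the dual graph. -/
abbrev Vertex : Type _ := Quotient (Equiv.Perm.SameCycle.setoid G.rot)

/-- Edges of `G`; each is also an edge of the dual graph. -/
abbrev Edge : Type _ := Quotient (Equiv.Perm.SameCycle.setoid G.rev)

/-- Faces of `G`, that is, vertices of the dual graph. -/
abbrev Face : Type _ := Quotient (Equiv.Perm.SameCycle.setoid G.facePerm)

/-- The vertex from which a dart emanates. -/
def vertexOf (d : D) : G.Vertex := Quotient.mk _ d

/-- The edge underlying a dart. -/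
def edgeOf (d : D) : G.Edge := Quotient.mk _ d

/-- The face to the left of a dart. The dual of the edge of `d` joins `faceOf d`
and `faceOf (rev d)`. -/
def faceOf (d : D) : G.Face := Quotient.mk _ d

/-- A vertex and a face of `G` are incident. -/
def Incident (v : G.Vertex) (f : G.Face) : Prop :=
  ∃ d, G.vertexOf d = v ∧ G.faceOf d = f

/-- Two faces of `G` are joined by an edge of the dual graph. -/
def DualAdj (f g : G.Face) : Prop :=
  ∃ d, G.faceOf d = f ∧ G.faceOf (G.rev d) = g

/-- A simple cycle, of length `n + 1 ≥ 1`, in the dual graph. It passes through the pairwise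
distinct faces `faceOf (dart m)` and uses the pairwise distinct edges `edgeOf (dart m)`; the
indices are cyclic (`Fin.last n + 1 = 0`). Length 1 is a loop, and length 2 is a pair of parallel
edges. -/
structure DualCycle where
  n : ℕ
  dart : Fin (n + 1) → D
  closed : ∀ m, G.faceOf (G.rev (dart m)) = G.faceOf (dart (m + 1))
  faces_inj : Function.Injective fun m => G.faceOf (dart m)
  edges_inj : Function.Injective fun m => G.edgeOf (dart m)

/-- The cells of the embedded dual graph: its vertices, its edges, and its faces. -/
inductive Cell
  | dualVertex (f : G.Face)
  | dualEdge (e : G.Edge)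
  | dualFace (v : G.Vertex)

variable {G}

namespace DualCycle

variable (C : G.DualCycle)

/-- The vertices of the dual graph (faces of `G`) on the cycle. -/
def faces : Set G.Face := Set.range fun m => G.faceOf (C.dart m)

/-- The edges on the cycle. -/
def edges : Set G.Edge := Set.range fun m => G.edgeOf (C.dart m)

/-- The cycle as a set of cells. -/
def cells : Set G.Cell := Cell.dualVertex '' C.faces ∪ Cell.dualEdge '' C.edges

/-- The total length of the edges on the cycle. -/
def cost (c : G.Edge → ℝ) : ℝ := ∑ m, c (G.edgeOf (C.dart m))

/-- Two faces of the dual graph lie in the same region of the complement of `C`: one passes from one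
to the other by crossing dual edges that are not on `C`, i.e. along edges of `G`. -/
def SameRegion : G.Vertex → G.Vertex → Prop :=
  Relation.ReflTransGen fun u v =>
    ∃ d, G.vertexOf d = u ∧ G.vertexOf (G.rev d) = v ∧ G.edgeOf d ∉ C.edges

/-- The faces of the dual graph inside `C`, where `o` is the outer face of the dual graph. -/
def inside (o : G.Vertex) : Set G.Vertex := {v | ¬ C.SameRegion o v}

/-- The interior of `C`, where `o` is the outer face of the dual graph: the region inside `C`,
including `C` itself. -/
def interior (o : G.Vertex) : Set G.Cell :=
  C.cells ∪
    (Cell.dualFace '' C.inside o ∪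
      Cell.dualEdge '' {e | ∃ d, G.edgeOf d = e ∧ G.vertexOf d ∈ C.inside o} ∪
      Cell.dualVertex '' {f | ∃ v ∈ C.inside o, G.Incident v f})

/-- `C` is a cut-cycle: its interior contains `s` and not `t`. The embedding is drawn with `t` in
the outer face of the dual graph, so that the interior of a cycle separating `s` from `t` is its
side containing `s`. -/
def IsCutCycle (s t : G.Vertex) : Prop :=
  Cell.dualFace s ∈ C.interior t ∧ Cell.dualFace t ∉ C.interior t

end DualCycle

variable (G) in
/-- A simple path `f 0, …, f n` in the dual graph, from a face incident to `s` to a face incident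
to `t`. -/
structure DualPath (s t : G.Vertex) (n : ℕ) where
  f : Fin (n + 1) → G.Face
  adj : ∀ m : Fin n, G.DualAdj (f m.castSucc) (f m.succ)
  inj : Function.Injective f
  start : G.Incident s (f 0)
  finish : G.Incident t (f (Fin.last n))

namespace DualCycle

variable {s t : G.Vertex} {n : ℕ}

/-- An `f_i`-cut-cycle with respect to the path `π`. -/
def IsFCutCycle (C : G.DualCycle) (π : G.DualPath s t n) (i : Fin (n + 1)) : Prop :=
  C.IsCutCycle s t ∧ π.f i ∈ C.faces ∧ ∀ j, i < j → π.f j ∉ C.faces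

/-- A minimum `f_i`-cut-cycle with respect to the path `π` and the capacities `c`. -/
def IsMinFCutCycle (C : G.DualCycle) (c : G.Edge → ℝ) (π : G.DualPath s t n)
    (i : Fin (n + 1)) : Prop :=
  C.IsFCutCycle π i ∧ ∀ C' : G.DualCycle, C'.IsFCutCycle π i → C.cost c ≤ C'.cost c

end DualCycle

end PlaneGraph

/-!
Uncross the two cut-cycles. Let `A` and `B` be the insides of an `f_i`-cut-cycle `Ci` and a minimum
`f_j`-cut-cycle `Cj`. Undirected cuts are submodular, so the cuts of `A ∪ B` and `A ∩ B` together
cost at most `c(Ci) + c(Cj)`. Each of these cuts contains the boundary of a set that contains `s`,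
omits `t`, and is connected with connected complement; on the sphere such a boundary is a single
dual cycle. The rest of `π` after `f_j` joins `t` to `f_j` outside `A ∪ B`, so the cycle obtained
from `A ∪ B` still passes through `f_j` and costs at least `c(Cj)`. Hence the one obtained from
`A ∩ B`, which lies inside `Cj` and is an `f_i'`-cut-cycle with `i' ≤ i`, costs at most `c(Ci)`.
Start from a minimum `Ci`: either `i' = i` and the new cycle is again minimum, or `i' < i` and one
repeats the argument with it.

The sphere enters through the mod 2 homology of the dual graph: by Euler's formula every mod 2 cycle
of dual edges is the coboundary of a two-colouring of the vertices of `G`.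
-/

namespace PlaneGraph

open Relation Module Function

variable {D : Type*} {G : PlaneGraph D}

lemma vertexOf_rot (d : D) : G.vertexOf (G.rot d) = G.vertexOf d :=
  Quotient.sound (Equiv.Perm.sameCycle_apply_left.2 (.refl _ _))

lemma edgeOf_rev (d : D) : G.edgeOf (G.rev d) = G.edgeOf d :=
  Quotient.sound (Equiv.Perm.sameCycle_apply_left.2 (.refl _ _))

lemma faceOf_facePerm (d : D) : G.faceOf (G.facePerm d) = G.faceOf d :=
  Quotient.sound (Equiv.Perm.sameCycle_apply_left.2 (.refl _ _))

lemma vertexOf_facePerm (d : D) : G.vertexOf (G.facePerm d) = G.vertexOf (G.rev d) := by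
  rw [← vertexOf_rot, facePerm, Equiv.Perm.mul_apply, Equiv.Perm.coe_inv, Equiv.apply_symm_apply]

lemma faceOf_rev_rot (d : D) : G.faceOf (G.rev (G.rot d)) = G.faceOf d := by
  rw [← faceOf_facePerm, facePerm, Equiv.Perm.mul_apply, G.rev_rev, Equiv.Perm.coe_inv,
    Equiv.symm_apply_apply]

lemma edgeOf_surjective : Surjective G.edgeOf := Quotient.exists_rep

lemma edgeOf_eq_edgeOf_iff {a b : D} : G.edgeOf a = G.edgeOf b ↔ a = b ∨ a = G.rev b := by
  refine ⟨fun h => ?_, by rintro (rfl | rfl) <;> simp only [edgeOf_rev]⟩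
  obtain ⟨k, hk⟩ : G.rev.SameCycle b a := Quotient.exact h.symm
  have hsq : G.rev ^ (2 : ℤ) = 1 := by
    rw [zpow_ofNat, pow_two]
    exact Equiv.ext G.rev_rev
  rcases Int.even_or_odd' k with ⟨m, rfl | rfl⟩
  · exact .inl (by simpa [zpow_mul, hsq] using hk.symm)
  · exact .inr (by simpa [zpow_add, zpow_mul, hsq] using hk.symm)

lemma incident_vertexOf (d : D) : G.Incident (G.vertexOf d) (G.faceOf d) := ⟨d, rfl, rfl⟩

lemma incident_vertexOf_rev (d : D) : G.Incident (G.vertexOf (G.rev d)) (G.faceOf d) :=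
  ⟨G.facePerm d, vertexOf_facePerm d, faceOf_facePerm d⟩

lemma incident_faceOf_rev (d : D) : G.Incident (G.vertexOf d) (G.faceOf (G.rev d)) := by
  simpa only [G.rev_rev] using incident_vertexOf_rev (G := G) (G.rev d)

lemma DualAdj.exists_incident {f g : G.Face} (h : G.DualAdj f g) :
    ∃ v, G.Incident v f ∧ G.Incident v g := by
  obtain ⟨d, rfl, rfl⟩ := h
  exact ⟨G.vertexOf d, incident_vertexOf d, incident_faceOf_rev d⟩

lemma dart_induction {P : D → Prop} (hrot : ∀ d, P (G.rot d) ↔ P d)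
    (hrev : ∀ d, P (G.rev d) ↔ P d) {a : D} (ha : P a) (b : D) : P b := by
  obtain ⟨g, hg, rfl⟩ := G.connected a b
  have hP : ∀ d, P (g d) ↔ P d := by
    induction hg using Subgroup.closure_induction with
    | mem x hx => rcases hx with rfl | rfl <;> assumption
    | one => exact fun _ => Iff.rfl
    | mul x y _ _ hx hy => exact fun d => (hx (y d)).trans (hy d)
    | inv x _ hx => exact fun d => by simpa using (hx (x⁻¹ d)).symm
  exact (hP a).2 ha

lemma vertex_induction {Q : Set G.Vertex}
    (h : ∀ d, G.vertexOf d ∈ Q → G.vertexOf (G.rev d) ∈ Q) {u : G.Vertex} (hu : u ∈ Q)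
    (v : G.Vertex) : v ∈ Q := by
  induction u using Quotient.inductionOn with | _ a
  induction v using Quotient.inductionOn with | _ b
  refine dart_induction (G := G) (P := fun d => G.vertexOf d ∈ Q)
    (fun d => by rw [vertexOf_rot]) (fun d => ⟨fun hd => ?_, h d⟩) hu b
  simpa only [G.rev_rev] using h _ hd

lemma face_induction {Q : Set G.Face}
    (h : ∀ d, G.faceOf d ∈ Q → G.faceOf (G.rev d) ∈ Q) {f : G.Face} (hf : f ∈ Q)
    (g : G.Face) : g ∈ Q := by
  induction f using Quotient.inductionOn with | _ a
  induction g using Quotient.inductionOn with | _ b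
  have hrev (d : D) : G.faceOf (G.rev d) ∈ Q ↔ G.faceOf d ∈ Q :=
    ⟨fun hd => by simpa only [G.rev_rev] using h _ hd, h d⟩
  exact dart_induction (G := G) (P := fun d => G.faceOf d ∈ Q)
    (fun d => by rw [← hrev, faceOf_rev_rot]) hrev hf b

lemma Incident.mem_of_mem [Finite D] {Q : Set G.Vertex} {f : G.Face} {u v : G.Vertex}
    (hu : G.Incident u f) (hv : G.Incident v f)
    (h : ∀ d, G.faceOf d = f → G.vertexOf d ∈ Q → G.vertexOf (G.rev d) ∈ Q) (huQ : u ∈ Q) :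
    v ∈ Q := by
  obtain ⟨a, rfl, rfl⟩ := hu
  obtain ⟨b, rfl, hb⟩ := hv
  obtain ⟨k, -, rfl⟩ := (Quotient.exact hb.symm : G.facePerm.SameCycle a b).exists_pow_eq'
  have hmem (k : ℕ) : G.faceOf ((G.facePerm ^ k) a) = G.faceOf a ∧
      G.vertexOf ((G.facePerm ^ k) a) ∈ Q := by
    induction k with
    | zero => exact ⟨rfl, huQ⟩
    | succ k ih =>
      rw [pow_succ', Equiv.Perm.mul_apply, faceOf_facePerm, vertexOf_facePerm]
      exact ⟨ih.1, h _ ih.1 ih.2⟩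
  exact (hmem k).2

/-! ### Mod 2 homology of the sphere -/

section Homology

variable [Fintype D]

open Classical in
variable (G) in
/-- The mod 2 coboundary of a function on the vertices of `G`. The sum runs over the two darts of
an edge. -/
noncomputable def coboundary : (G.Vertex → ZMod 2) →ₗ[ZMod 2] (G.Edge → ZMod 2) where
  toFun p e := ∑ d with G.edgeOf d = e, p (G.vertexOf d)
  map_add' p q := by ext; simp [Finset.sum_add_distrib]
  map_smul' r p := by ext; simp [Finset.mul_sum]

open Classical in
variable (G) in
/-- The mod 2 boundary, in the dual graph, of a function on the edges. The sum runs over the darts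
around a face of `G`, so that a dual loop is counted twice. -/
noncomputable def dualBoundary : (G.Edge → ZMod 2) →ₗ[ZMod 2] (G.Face → ZMod 2) where
  toFun x f := ∑ d with G.faceOf d = f, x (G.edgeOf d)
  map_add' x y := by ext; simp [Finset.sum_add_distrib]
  map_smul' r x := by ext; simp [Finset.mul_sum]

open Classical in
lemma filter_edgeOf_eq (d : D) :
    (Finset.univ.filter fun a => G.edgeOf a = G.edgeOf d) = {d, G.rev d} := by
  ext a
  simp [edgeOf_eq_edgeOf_iff]

lemma coboundary_edgeOf (p : G.Vertex → ZMod 2) (d : D) :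
    G.coboundary p (G.edgeOf d) = p (G.vertexOf d) + p (G.vertexOf (G.rev d)) := by
  classical
  simp only [coboundary, LinearMap.coe_mk, AddHom.coe_mk, filter_edgeOf_eq]
  exact Finset.sum_pair (G.rev_ne d).symm

open Classical in
lemma dualBoundary_single (d : D) :
    G.dualBoundary (Pi.single (G.edgeOf d) 1) =
      Pi.single (G.faceOf d) 1 + Pi.single (G.faceOf (G.rev d)) 1 := by
  ext f
  calc G.dualBoundary (Pi.single (G.edgeOf d) 1) f
      = ∑ a with G.edgeOf a = G.edgeOf d, if G.faceOf a = f then 1 else 0 := by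
        simp only [dualBoundary, LinearMap.coe_mk, AddHom.coe_mk, Pi.single_apply,
          Finset.sum_filter, ← ite_and, and_comm]
    _ = (if G.faceOf d = f then 1 else 0) + if G.faceOf (G.rev d) = f then 1 else 0 := by
        rw [filter_edgeOf_eq, Finset.sum_pair (G.rev_ne d).symm]
    _ = _ := by simp only [Pi.add_apply, Pi.single_apply, eq_comm]

lemma dualBoundary_coboundary (p : G.Vertex → ZMod 2) : G.dualBoundary (G.coboundary p) = 0 := by
  classical
  ext f
  have hrot : ∑ d with G.faceOf d = f, p (G.vertexOf (G.rev d)) =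
      ∑ d with G.faceOf d = f, p (G.vertexOf d) :=
    Finset.sum_equiv G.facePerm (fun d => by simp [faceOf_facePerm])
      fun d _ => by rw [vertexOf_facePerm]
  simp only [dualBoundary, LinearMap.coe_mk, AddHom.coe_mk, coboundary_edgeOf,
    Finset.sum_add_distrib, hrot, CharTwo.add_self_eq_zero, Pi.zero_apply]

lemma finrank_ker_coboundary_le : finrank (ZMod 2) (LinearMap.ker G.coboundary) ≤ 1 := by
  have hone : (1 : G.Vertex → ZMod 2) ∈ LinearMap.ker G.coboundary := by
    ext e
    obtain ⟨d, rfl⟩ := edgeOf_surjective e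
    exact (coboundary_edgeOf 1 d).trans (CharTwo.add_self_eq_zero 1)
  refine finrank_le_one ⟨1, hone⟩ fun ⟨p, hp⟩ => ?_
  rcases isEmpty_or_nonempty G.Vertex with _ | ⟨⟨v⟩⟩
  · exact ⟨0, Subtype.ext (Subsingleton.elim _ _)⟩
  have hconst : ∀ w, w ∈ {w | p v = p w} := vertex_induction (fun d (hd : p v = _) => by
    have h := congrFun hp (G.edgeOf d)
    rw [coboundary_edgeOf, Pi.zero_apply, CharTwo.add_eq_zero] at h
    exact hd.trans h) (u := v) rfl
  exact ⟨p v, Subtype.ext (funext fun w => by simpa using hconst w)⟩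

lemma card_face_le : Nat.card G.Face ≤ finrank (ZMod 2) (LinearMap.range G.dualBoundary) + 1 := by
  classical
  have := Fintype.ofFinite G.Face
  rcases isEmpty_or_nonempty G.Face with _ | ⟨⟨f₀⟩⟩
  · simp
  let single (f : G.Face) : G.Face → ZMod 2 := Pi.single f 1
  let W := LinearMap.range G.dualBoundary ⊔ Submodule.span (ZMod 2) {single f₀}
  -- The dual graph is connected, so any two faces are homologous.
  have hmem : ∀ f, single f ∈ W := by
    refine face_induction (Q := {f | single f ∈ W}) (fun d hd => ?_)
      (Submodule.mem_sup_right (Submodule.mem_span_singleton_self _))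
    have hsum : single (G.faceOf d) + single (G.faceOf (G.rev d)) ∈
        LinearMap.range G.dualBoundary := ⟨_, dualBoundary_single d⟩
    exact (Submodule.add_mem_iff_right _ hd).1 (Submodule.mem_sup_left hsum)
  have htop : W = ⊤ := by
    rw [eq_top_iff, ← (Pi.basisFun (ZMod 2) G.Face).span_eq, Submodule.span_le]
    rintro _ ⟨f, rfl⟩
    rw [Pi.basisFun_apply]
    exact hmem f
  calc Nat.card G.Face = finrank (ZMod 2) (⊤ : Submodule (ZMod 2) (G.Face → ZMod 2)) := by
        rw [finrank_top, finrank_fintype_fun_eq_card, Nat.card_eq_fintype_card]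
    _ ≤ finrank (ZMod 2) (LinearMap.range G.dualBoundary) +
          finrank (ZMod 2) (Submodule.span (ZMod 2) {single f₀}) :=
        htop ▸ Submodule.finrank_add_le_finrank_add_finrank _ _
    _ ≤ finrank (ZMod 2) (LinearMap.range G.dualBoundary) + 1 := by
        gcongr
        simpa using finrank_span_le_card (R := ZMod 2) {single f₀}

lemma range_coboundary_eq_ker_dualBoundary :
    LinearMap.range G.coboundary = LinearMap.ker G.dualBoundary := by
  have := Fintype.ofFinite G.Vertex
  have := Fintype.ofFinite G.Edge
  have hle : LinearMap.range G.coboundary ≤ LinearMap.ker G.dualBoundary := by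
    rintro _ ⟨p, rfl⟩
    exact dualBoundary_coboundary p
  have hvertex := G.coboundary.finrank_range_add_finrank_ker
  have hedge := G.dualBoundary.finrank_range_add_finrank_ker
  have heuler : Nat.card G.Vertex + Nat.card G.Face = Nat.card G.Edge + 2 := G.euler
  rw [finrank_fintype_fun_eq_card, ← Nat.card_eq_fintype_card] at hvertex hedge
  have hker := finrank_ker_coboundary_le (G := G)
  have hface := card_face_le (G := G)
  exact Submodule.eq_of_le_of_finrank_le hle (by omega)

end Homology

namespace DualCycle

variable {C : G.DualCycle}

lemma edgeOf_dart_mem_edges (m : Fin (C.n + 1)) : G.edgeOf (C.dart m) ∈ C.edges := ⟨m, rfl⟩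

lemma faceOf_dart_mem_faces (m : Fin (C.n + 1)) : G.faceOf (C.dart m) ∈ C.faces := ⟨m, rfl⟩

lemma faceOf_mem_faces {d : D} (h : G.edgeOf d ∈ C.edges) : G.faceOf d ∈ C.faces := by
  obtain ⟨m, hm⟩ := h
  rcases edgeOf_eq_edgeOf_iff.1 hm.symm with rfl | rfl
  · exact faceOf_dart_mem_faces m
  · exact ⟨m + 1, (C.closed m).symm⟩

open Classical in
lemma dualBoundary_eq_sum [Fintype D] {x : G.Edge → ZMod 2} (hx : ∀ e ∉ C.edges, x e = 0) :
    G.dualBoundary x = ∑ m, x (G.edgeOf (C.dart m)) •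
      (Pi.single (G.faceOf (C.dart m)) 1 + Pi.single (G.faceOf (C.dart (m + 1))) 1) := by
  have := Fintype.ofFinite G.Edge
  have hsum : x = ∑ m, x (G.edgeOf (C.dart m)) • Pi.single (G.edgeOf (C.dart m)) 1 :=
    (pi_eq_sum_univ' x).trans (Fintype.sum_of_injective _ C.edges_inj _ _
      (fun e he => by rw [hx e he, zero_smul]) fun _ => rfl).symm
  conv_lhs => rw [hsum]
  simp only [map_sum, map_smul, dualBoundary_single, C.closed]

lemma dualBoundary_indicator_edges [Fintype D] : G.dualBoundary (C.edges.indicator 1) = 0 := by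
  classical
  have hshift : ∑ m, (Pi.single (G.faceOf (C.dart (m + 1))) 1 : G.Face → ZMod 2) =
      ∑ m, Pi.single (G.faceOf (C.dart m)) 1 :=
    Fintype.sum_equiv (Equiv.addRight 1) _ _ fun _ => rfl
  rw [dualBoundary_eq_sum fun e he => Set.indicator_of_notMem he 1]
  simp only [Set.indicator_of_mem (edgeOf_dart_mem_edges _), Pi.one_apply, one_smul,
    Finset.sum_add_distrib, hshift]
  exact funext fun _ => CharTwo.add_self_eq_zero _

variable (C) in
lemma exists_twoColoring [Finite D] : ∃ p : G.Vertex → ZMod 2,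
    ∀ d, p (G.vertexOf d) ≠ p (G.vertexOf (G.rev d)) ↔ G.edgeOf d ∈ C.edges := by
  have := Fintype.ofFinite D
  obtain ⟨p, hp⟩ : C.edges.indicator 1 ∈ LinearMap.range G.coboundary := by
    rw [range_coboundary_eq_ker_dualBoundary]
    exact dualBoundary_indicator_edges
  refine ⟨p, fun d => ?_⟩
  rw [Ne, ← CharTwo.add_eq_zero, ← coboundary_edgeOf, hp]
  simp

lemma dualBoundary_faceOf_dart_succ [Fintype D] {x : G.Edge → ZMod 2}
    (hx : ∀ e ∉ C.edges, x e = 0) (k : Fin (C.n + 1)) :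
    G.dualBoundary x (G.faceOf (C.dart (k + 1))) =
      x (G.edgeOf (C.dart (k + 1))) + x (G.edgeOf (C.dart k)) := by
  classical
  have hface (a b : Fin (C.n + 1)) : G.faceOf (C.dart a) = G.faceOf (C.dart b) ↔ a = b :=
    C.faces_inj.eq_iff
  simp [dualBoundary_eq_sum hx, Pi.single_apply, hface, Finset.sum_add_distrib]

lemma edges_eq_of_subset [Finite D] {C' : G.DualCycle} (h : C'.edges ⊆ C.edges) :
    C'.edges = C.edges := by
  have := Fintype.ofFinite D
  let x : G.Edge → ZMod 2 := C'.edges.indicator 1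
  have hsupp : ∀ e ∉ C.edges, x e = 0 := fun e he =>
    Set.indicator_of_notMem (fun he' => he (h he')) 1
  have hstep (k : Fin (C.n + 1)) :
      x (G.edgeOf (C.dart (k + 1))) = x (G.edgeOf (C.dart k)) := by
    rw [← CharTwo.add_eq_zero, ← dualBoundary_faceOf_dart_succ hsupp, dualBoundary_indicator_edges,
      Pi.zero_apply]
  have hconst (k : Fin (C.n + 1)) : x (G.edgeOf (C.dart k)) = x (G.edgeOf (C.dart 0)) := by
    induction k using Fin.induction with
    | zero => rfl
    | succ k ih => rw [← Fin.coeSucc_eq_succ, hstep, ih]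
  have hone {e : G.Edge} : x e = 1 ↔ e ∈ C'.edges := Set.indicator_eq_one_iff_mem (ZMod 2)
  obtain ⟨m, hm⟩ := h (edgeOf_dart_mem_edges (C := C') 0)
  refine h.antisymm ?_
  rintro _ ⟨k, rfl⟩
  rw [← hone, hconst, ← hconst m, hone]
  exact Set.mem_of_eq_of_mem hm (edgeOf_dart_mem_edges 0)

end DualCycle

/-! ### Cuts and their boundary cycles -/

/-- The darts that leave a set of vertices. -/
def cutDarts (A : Set G.Vertex) : Set D :=
  {d | G.vertexOf d ∈ A ∧ G.vertexOf (G.rev d) ∉ A}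

/-- The undirected cut of a set of vertices. -/
def cutEdges (A : Set G.Vertex) : Set G.Edge := G.edgeOf '' cutDarts A

lemma edgeOf_mem_cutEdges_iff {A : Set G.Vertex} {d : D} :
    G.edgeOf d ∈ cutEdges A ↔ ¬(G.vertexOf d ∈ A ↔ G.vertexOf (G.rev d) ∈ A) := by
  constructor
  · rintro ⟨a, ⟨ha, ha'⟩, h⟩
    rcases edgeOf_eq_edgeOf_iff.1 h with rfl | rfl
    · tauto
    · rw [G.rev_rev] at ha'
      tauto
  · intro h
    by_cases hd : G.vertexOf d ∈ A
    · exact ⟨d, ⟨hd, by tauto⟩, rfl⟩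
    · exact ⟨G.rev d, ⟨by tauto, by rwa [G.rev_rev]⟩, edgeOf_rev d⟩

lemma cutDarts_nonempty {A : Set G.Vertex} {s t : G.Vertex} (hs : s ∈ A) (ht : t ∉ A) :
    (cutDarts A).Nonempty := by
  by_contra hempty
  refine ht (vertex_induction (fun d hd => ?_) hs t)
  by_contra hd'
  exact hempty ⟨d, hd, hd'⟩

lemma exists_mem_cutDarts_of_incident [Finite D] {A : Set G.Vertex} {u v : G.Vertex} {f : G.Face}
    (hu : G.Incident u f) (hv : G.Incident v f) (huA : u ∈ A) (hvA : v ∉ A) :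
    ∃ d ∈ cutDarts A, G.faceOf d = f := by
  by_contra! hcut
  refine hvA (hu.mem_of_mem hv (fun d hd hdA => ?_) huA)
  by_contra hdA'
  exact hcut d ⟨hdA, hdA'⟩ hd

lemma exists_mem_periodicPts {α : Type*} [Finite α] [Nonempty α] (φ : α → α) :
    ∃ x, x ∈ periodicPts φ := by
  obtain ⟨x⟩ := ‹Nonempty α›
  obtain ⟨a, b, hab, h⟩ : ∃ a b, a < b ∧ φ^[a] x = φ^[b] x := by
    obtain ⟨a, b, hne, h⟩ := Finite.exists_ne_map_eq_of_infinite fun k => φ^[k] x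
    exact hne.lt_or_gt.elim (⟨a, b, ·, h⟩) (⟨b, a, ·, h.symm⟩)
  refine ⟨φ^[a] x, mk_mem_periodicPts (Nat.sub_pos_of_lt hab) ?_⟩
  rw [IsPeriodicPt, IsFixedPt, ← iterate_add_apply, Nat.sub_add_cancel hab.le, h]

lemma exists_dualCycle_of_forall_exists_next [Finite D] {X : Set D} (hX : X.Nonempty)
    (hrev : ∀ d ∈ X, G.rev d ∉ X) (hnext : ∀ d ∈ X, ∃ d' ∈ X, G.faceOf d' = G.faceOf (G.rev d)) :
    ∃ C : G.DualCycle, ∀ m, C.dart m ∈ X := by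
  let F := G.faceOf '' X
  have : Nonempty F := (hX.image _).to_subtype
  choose out hout hface using fun f : F => f.2
  have hF (f : F) : G.faceOf (G.rev (out f)) ∈ F := hnext _ (hout f)
  let next (f : F) : F := ⟨_, hF f⟩
  obtain ⟨f, hf⟩ := exists_mem_periodicPts next
  obtain ⟨n, hn⟩ := Nat.exists_eq_succ_of_ne_zero (minimalPeriod_pos_of_mem_periodicPts hf).ne'
  have hinj : Injective fun m : Fin (n + 1) => G.faceOf (out (next^[m] f)) := fun a b h => by
    simp only [hface] at h
    exact Fin.ext (iterate_injOn_Iio_minimalPeriod (hn ▸ a.2) (hn ▸ b.2) (Subtype.ext h))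
  refine ⟨⟨n, fun m => out (next^[m] f), fun m => ?_, hinj, fun a b h => ?_⟩, fun m => hout _⟩
  · have hperiod : next^[(m + 1 : Fin (n + 1))] f = next (next^[m] f) := by
      rw [← iterate_succ_apply' next m f, ← iterate_mod_minimalPeriod_eq (n := m.1.succ), hn,
        Fin.val_add, Fin.val_one', Nat.add_mod_mod]
    rw [hperiod, hface]
  · rcases edgeOf_eq_edgeOf_iff.1 h with h | h
    · exact hinj (congrArg G.faceOf h)
    · exact absurd (h ▸ hout _) (hrev _ (hout _))

lemma exists_dualCycle_of_cutDarts_nonempty [Finite D] {A : Set G.Vertex}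
    (hA : (cutDarts A).Nonempty) : ∃ C : G.DualCycle, ∀ m, C.dart m ∈ cutDarts A :=
  exists_dualCycle_of_forall_exists_next hA
    (fun _ hd hd' => hd.2 hd'.1)
    fun d hd => exists_mem_cutDarts_of_incident (incident_faceOf_rev d)
      (incident_vertexOf (G.rev d)) hd.1 hd.2

section Component

variable {A B U W : Set G.Vertex} {x s t : G.Vertex}

/-- The vertices that can be reached from `x` by a walk whose vertices after `x` all lie in `U`.
For `x ∈ U` this is the connected component of `x` in the subgraph induced on `U`. -/
def component (U : Set G.Vertex) (x : G.Vertex) : Set G.Vertex :=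
  {v | ReflTransGen (fun a b => b ∈ U ∧ ∃ d, G.vertexOf d = a ∧ G.vertexOf (G.rev d) = b) x v}

lemma mem_component_self : x ∈ component U x := .refl

lemma vertexOf_rev_mem_component {d : D} (hd : G.vertexOf d ∈ component U x)
    (hU : G.vertexOf (G.rev d) ∈ U) : G.vertexOf (G.rev d) ∈ component U x :=
  ReflTransGen.tail hd ⟨hU, d, rfl, rfl⟩

lemma component_subset (hx : x ∈ W)
    (h : ∀ d, G.vertexOf d ∈ W → G.vertexOf (G.rev d) ∈ U → G.vertexOf (G.rev d) ∈ W) :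
    component U x ⊆ W := by
  intro v hv
  induction hv with
  | refl => exact hx
  | tail _ hab ih =>
    obtain ⟨hb, d, rfl, rfl⟩ := hab
    exact h d ih hb

lemma component_subset_self (hx : x ∈ U) : component U x ⊆ U :=
  component_subset hx fun _ _ hd => hd

lemma component_mono (h : U ⊆ W) : component U x ⊆ component W x :=
  component_subset mem_component_self fun _ hd hU => vertexOf_rev_mem_component hd (h hU)

lemma component_subset_component_component : component U x ⊆ component (component U x) x := by
  refine component_subset mem_component_self fun d hd hU => vertexOf_rev_mem_component hd ?_
  exact vertexOf_rev_mem_component (component_subset_self mem_component_self hd) hU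

lemma compl_component_compl_subset (hW : W ⊆ component W t) (hs : s ∉ W) :
    (component Wᶜ s)ᶜ ⊆ component (component Wᶜ s)ᶜ t := by
  have hWcompl : W ⊆ (component Wᶜ s)ᶜ := fun v hv hv' => component_subset_self hs hv' hv
  have hall : ∀ v, v ∈ component Wᶜ s ∪ component (component Wᶜ s)ᶜ t := by
    refine vertex_induction (fun d hd => ?_) (.inl (mem_component_self (x := s)))
    by_cases hd' : G.vertexOf (G.rev d) ∈ component Wᶜ s
    · exact .inl hd'
    · refine .inr (hd.elim (fun hd => ?_) fun hd => vertexOf_rev_mem_component hd hd')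
      by_contra hcontra
      exact hd' (vertexOf_rev_mem_component hd
        fun hW' => hcontra (component_mono hWcompl (hW hW')))
  exact fun v hv => (hall v).resolve_left hv

lemma eq_of_mem_component {α : Type*} {p : G.Vertex → α}
    (h : ∀ d, G.vertexOf d ∈ U → G.vertexOf (G.rev d) ∈ U →
      p (G.vertexOf (G.rev d)) = p (G.vertexOf d))
    (hx : x ∈ U) {v : G.Vertex} (hv : v ∈ component U x) : p v = p x :=
  (component_subset (W := {v | v ∈ U ∧ p v = p x}) ⟨hx, rfl⟩
    (fun d hd hU => ⟨hU, (h d hd.1 hU).trans hd.2⟩) hv).2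

lemma cutDarts_component_subset (hx : x ∈ U) : cutDarts (component U x) ⊆ cutDarts U :=
  fun _ hd => ⟨component_subset_self hx hd.1,
    fun hU => hd.2 (vertexOf_rev_mem_component hd.1 hU)⟩

lemma cutDarts_compl_component_compl_subset (ht : t ∉ A) :
    cutDarts (component Aᶜ t)ᶜ ⊆ cutDarts A := by
  rintro d ⟨hd, hd'⟩
  rw [Set.notMem_compl_iff] at hd'
  refine ⟨?_, component_subset_self ht hd'⟩
  by_contra hA
  have hcomp := vertexOf_rev_mem_component hd' (by rwa [G.rev_rev])
  rw [G.rev_rev] at hcomp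
  exact hd hcomp

/-- The component of `s` after deleting from `G` the component of `t` in the complement of `A`. If
`s ∈ A` and `t ∉ A`, it is connected with connected complement, and its cut is part of the cut
of `A`. -/
def hull (A : Set G.Vertex) (s t : G.Vertex) : Set G.Vertex :=
  component (component Aᶜ t)ᶜ s

lemma mem_hull : s ∈ hull A s t := mem_component_self

lemma notMem_component_compl (hs : s ∈ A) (ht : t ∉ A) : s ∉ component Aᶜ t :=
  fun h => component_subset_self ht h hs

lemma hull_subset (hs : s ∈ A) (ht : t ∉ A) : hull A s t ⊆ (component Aᶜ t)ᶜ :=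
  component_subset_self (notMem_component_compl hs ht)

lemma notMem_hull (hs : s ∈ A) (ht : t ∉ A) : t ∉ hull A s t :=
  fun h => hull_subset hs ht h mem_component_self

lemma component_subset_hull (hAB : B ⊆ A) (ht : t ∉ A) : component B s ⊆ hull A s t :=
  component_mono fun _ hv hv' => component_subset_self ht hv' (hAB hv)

lemma cutDarts_hull_subset (hs : s ∈ A) (ht : t ∉ A) : cutDarts (hull A s t) ⊆ cutDarts A :=
  (cutDarts_component_subset (notMem_component_compl hs ht)).trans
    (cutDarts_compl_component_compl_subset ht)

lemma exists_dualCycle_range_dart_eq_cutDarts [Finite D] (hs : s ∈ A) (ht : t ∉ A)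
    (hA : A ⊆ component A s) (hA' : Aᶜ ⊆ component Aᶜ t) :
    ∃ C : G.DualCycle, Set.range C.dart = cutDarts A := by
  obtain ⟨C, hC⟩ := exists_dualCycle_of_cutDarts_nonempty (cutDarts_nonempty hs ht)
  refine ⟨C, (Set.range_subset_iff.2 hC).antisymm fun d hd => ?_⟩
  obtain ⟨p, hp⟩ := C.exists_twoColoring
  have hedges : C.edges ⊆ cutEdges A := by
    rintro _ ⟨m, rfl⟩
    exact ⟨_, hC m, rfl⟩
  have hcolor (a : D) (ha : G.vertexOf a ∈ A ↔ G.vertexOf (G.rev a) ∈ A) :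
      p (G.vertexOf (G.rev a)) = p (G.vertexOf a) := by
    by_contra hne
    exact edgeOf_mem_cutEdges_iff.1 (hedges ((hp a).1 (Ne.symm hne))) ha
  have hps {v : G.Vertex} (hv : v ∈ A) : p v = p s :=
    eq_of_mem_component (fun a ha ha' => hcolor a (iff_of_true ha ha')) hs (hA hv)
  have hpt {v : G.Vertex} (hv : v ∉ A) : p v = p t :=
    eq_of_mem_component (fun a ha ha' => hcolor a (iff_of_false ha ha')) ht (hA' hv)
  have hst : p s ≠ p t := by
    rw [← hps (hC 0).1, ← hpt (hC 0).2]
    exact (hp _).2 (DualCycle.edgeOf_dart_mem_edges 0)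
  obtain ⟨m, hm⟩ : G.edgeOf d ∈ C.edges := (hp d).1 (by rwa [hps hd.1, hpt hd.2])
  rcases edgeOf_eq_edgeOf_iff.1 hm with h | h
  · exact ⟨m, h⟩
  · exact absurd (h ▸ hC m).1 hd.2

lemma exists_dualCycle_range_dart_eq_cutDarts_hull [Finite D] (hs : s ∈ A) (ht : t ∉ A) :
    ∃ C : G.DualCycle, Set.range C.dart = cutDarts (hull A s t) := by
  refine exists_dualCycle_range_dart_eq_cutDarts mem_hull (notMem_hull hs ht)
    component_subset_component_component ?_
  exact compl_component_compl_subset component_subset_component_component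
    (notMem_component_compl hs ht)

end Component

namespace DualCycle

variable {C : G.DualCycle} {A : Set G.Vertex} {s t : G.Vertex}

lemma notMem_inside_self : t ∉ C.inside t := fun h => h .refl

lemma isCutCycle_iff : C.IsCutCycle s t ↔ s ∈ C.inside t := by
  have hmem (v : G.Vertex) : Cell.dualFace v ∈ C.interior t ↔ v ∈ C.inside t := by
    simp [interior, cells]
  rw [IsCutCycle, hmem, hmem, and_iff_left notMem_inside_self]

lemma vertexOf_rev_mem_inside_iff {d : D} (hd : G.edgeOf d ∉ C.edges) :
    G.vertexOf (G.rev d) ∈ C.inside t ↔ G.vertexOf d ∈ C.inside t :=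
  not_congr ⟨fun h => h.tail ⟨G.rev d, rfl, by rw [G.rev_rev], by rwa [edgeOf_rev]⟩,
    fun h => h.tail ⟨d, rfl, rfl, hd⟩⟩

lemma cutEdges_inside_subset : cutEdges (C.inside t) ⊆ C.edges := by
  rintro _ ⟨d, hd, rfl⟩
  by_contra he
  exact hd.2 ((vertexOf_rev_mem_inside_iff he).2 hd.1)

lemma isCutCycle_of_cutDarts_subset (hs : s ∈ A) (ht : t ∉ A)
    (hA : cutDarts A ⊆ Set.range C.dart) : C.IsCutCycle s t := by
  have hregion {v : G.Vertex} (hv : C.SameRegion t v) : v ∉ A := by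
    induction hv with
    | refl => exact ht
    | tail _ hd ih =>
      obtain ⟨d, rfl, rfl, hd⟩ := hd
      intro hA'
      obtain ⟨m, hm⟩ := hA (show G.rev d ∈ cutDarts A from ⟨hA', by rwa [G.rev_rev]⟩)
      exact hd ⟨m, by simp only [hm, edgeOf_rev]⟩
  exact isCutCycle_iff.2 fun h => hregion h hs

lemma cells_subset_interior {C' : G.DualCycle}
    (h : ∀ m, G.vertexOf (C.dart m) ∈ C'.inside t) : C.cells ⊆ C'.interior t := by
  rintro _ (⟨_, ⟨m, rfl⟩, rfl⟩ | ⟨_, ⟨m, rfl⟩, rfl⟩)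
  · exact .inr (.inr ⟨_, ⟨_, h m, incident_vertexOf _⟩, rfl⟩)
  · exact .inr (.inl (.inr ⟨_, ⟨_, rfl, h m⟩, rfl⟩))

lemma exists_incident_of_mem_faces (hC : Set.range C.dart ⊆ cutDarts A) {f : G.Face}
    (hf : f ∈ C.faces) : ∃ v ∈ A, G.Incident v f := by
  obtain ⟨m, rfl⟩ := hf
  exact ⟨_, (hC ⟨m, rfl⟩).1, incident_vertexOf _⟩

lemma IsCutCycle.exists_mem_component [Finite D] (hC : C.IsCutCycle s t) {f : G.Face}
    (hf : f ∈ C.faces) : ∃ u ∈ component (C.inside t) s, G.Incident u f := by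
  have hs := isCutCycle_iff.1 hC
  obtain ⟨C', hC'⟩ := exists_dualCycle_of_cutDarts_nonempty (cutDarts_nonempty mem_component_self
    fun h => notMem_inside_self (component_subset_self hs h))
  have hsubset : C'.edges ⊆ C.edges := by
    rintro _ ⟨m, rfl⟩
    exact cutEdges_inside_subset ⟨_, cutDarts_component_subset hs (hC' m), rfl⟩
  obtain ⟨m, rfl⟩ := hf
  obtain ⟨m', hm'⟩ : G.edgeOf (C.dart m) ∈ C'.edges :=
    edges_eq_of_subset hsubset ▸ edgeOf_dart_mem_edges m
  refine ⟨_, (hC' m').1, ?_⟩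
  rcases edgeOf_eq_edgeOf_iff.1 hm'.symm with h | h
  · simp only [h, incident_vertexOf]
  · simp only [h, incident_faceOf_rev]

end DualCycle

lemma DualPath.exists_incident_mem [Finite D] {s t : G.Vertex} {n : ℕ} (π : G.DualPath s t n)
    {T : Set G.Vertex} (ht : t ∈ T) (l : Fin (n + 1))
    (h : ∀ m, l < m → ∀ d, G.faceOf d = π.f m → G.vertexOf d ∈ T → G.vertexOf (G.rev d) ∈ T) :
    ∃ v ∈ T, G.Incident v (π.f l) := by
  induction l using Fin.reverseInduction with
  | last => exact ⟨t, ht, π.finish⟩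
  | cast l ih =>
    obtain ⟨u, hu, huf⟩ := ih fun m hm => h m (Fin.castSucc_lt_succ.trans hm)
    obtain ⟨v, hv, hvf⟩ := (π.adj l).exists_incident
    exact ⟨v, huf.mem_of_mem hvf (h _ Fin.castSucc_lt_succ) hu, hv⟩

namespace DualCycle

section Path

variable [Finite D] {C : G.DualCycle} {s t v : G.Vertex} {n : ℕ} {π : G.DualPath s t n}
  {i l : Fin (n + 1)}

lemma notMem_inside_of_incident (h : ∀ m, l ≤ m → π.f m ∉ C.faces)
    (hv : G.Incident v (π.f l)) : v ∉ C.inside t := by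
  have hstep (m : Fin (n + 1)) (hm : l ≤ m) (d : D) (hd : G.faceOf d = π.f m)
      (hdt : G.vertexOf d ∈ (C.inside t)ᶜ) : G.vertexOf (G.rev d) ∈ (C.inside t)ᶜ := by
    rwa [Set.mem_compl_iff, vertexOf_rev_mem_inside_iff fun he => h m hm (hd ▸ faceOf_mem_faces he)]
  obtain ⟨u, hu, huf⟩ := π.exists_incident_mem (T := (C.inside t)ᶜ) notMem_inside_self l
    fun m hm => hstep m hm.le
  exact huf.mem_of_mem hv (hstep l le_rfl) hu

lemma IsFCutCycle.notMem_inside (hC : C.IsFCutCycle π i) (hil : i < l)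
    (hv : G.Incident v (π.f l)) : v ∉ C.inside t :=
  notMem_inside_of_incident (fun m hm => hC.2.2 m (hil.trans_le hm)) hv

variable (π) in
lemma IsCutCycle.exists_isFCutCycle (hC : C.IsCutCycle s t) : ∃ i, C.IsFCutCycle π i := by
  have hne : {l | π.f l ∈ C.faces}.Nonempty := by
    by_contra hempty
    exact notMem_inside_of_incident (fun m _ hm => hempty ⟨m, hm⟩) π.start (isCutCycle_iff.1 hC)
  obtain ⟨i, hi, hmax⟩ := Set.exists_max_image _ id (Set.toFinite _) hne
  exact ⟨i, hC, hi, fun l hil hl => (hmax l hl).not_gt hil⟩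

end Path

end DualCycle

/-! ### Uncrossing -/

section Weight

variable {c : G.Edge → ℝ}

/-- The total capacity of a set of edges. -/
noncomputable def weight (c : G.Edge → ℝ) (K : Set G.Edge) : ℝ := ∑ᶠ e ∈ K, c e

lemma DualCycle.cost_eq_weight (C : G.DualCycle) : C.cost c = weight c C.edges := by
  rw [cost, weight, edges, finsum_mem_range C.edges_inj, finsum_eq_sum_of_fintype]

lemma weight_mono [Finite D] (hc : ∀ e, 0 ≤ c e) {K L : Set G.Edge} (h : K ⊆ L) :
    weight c K ≤ weight c L := by
  rw [weight, weight, finsum_mem_def, finsum_mem_def]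
  exact finsum_le_finsum' (Set.toFinite _) (Set.toFinite _)
    (Set.indicator_le_indicator_of_subset h hc)

lemma weight_cutEdges_union_add_inter_le [Finite D] (hc : ∀ e, 0 ≤ c e) (A B : Set G.Vertex) :
    weight c (cutEdges (A ∪ B)) + weight c (cutEdges (A ∩ B)) ≤
      weight c (cutEdges A) + weight c (cutEdges B) := by
  have hunion : cutEdges (A ∪ B) ∪ cutEdges (A ∩ B) ⊆ cutEdges A ∪ cutEdges B := by
    intro e
    obtain ⟨d, rfl⟩ := edgeOf_surjective e
    simp only [Set.mem_union, Set.mem_inter_iff, edgeOf_mem_cutEdges_iff]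
    tauto
  have hinter : cutEdges (A ∪ B) ∩ cutEdges (A ∩ B) ⊆ cutEdges A ∩ cutEdges B := by
    intro e
    obtain ⟨d, rfl⟩ := edgeOf_surjective e
    simp only [Set.mem_union, Set.mem_inter_iff, edgeOf_mem_cutEdges_iff]
    tauto
  have hmodular (K L : Set G.Edge) :
      weight c (K ∪ L) + weight c (K ∩ L) = weight c K + weight c L :=
    finsum_mem_union_inter (Set.toFinite K) (Set.toFinite L)
  rw [← hmodular (cutEdges (A ∪ B)), ← hmodular (cutEdges A)]
  exact add_le_add (weight_mono hc hunion) (weight_mono hc hinter)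

end Weight

namespace DualCycle

section Uncrossing

variable [Finite D] {C Ci Cj : G.DualCycle} {A : Set G.Vertex} {s t : G.Vertex} {n : ℕ}
  {π : G.DualPath s t n} {i j : Fin (n + 1)} {c : G.Edge → ℝ}

lemma IsFCutCycle.exists_isMinFCutCycle (hC : C.IsFCutCycle π i) (c : G.Edge → ℝ) :
    ∃ C' : G.DualCycle, C'.IsMinFCutCycle c π i := by
  obtain ⟨_, ⟨C', hC', rfl⟩, hmin⟩ := Set.exists_min_image
    (edges '' {C : G.DualCycle | C.IsFCutCycle π i}) (weight c) (Set.toFinite _) ⟨_, C, hC, rfl⟩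
  refine ⟨C', hC', fun C'' hC'' => ?_⟩
  rw [cost_eq_weight, cost_eq_weight]
  exact hmin _ ⟨C'', hC'', rfl⟩

lemma cost_le_weight_cutEdges (hc : ∀ e, 0 ≤ c e) (hC : Set.range C.dart ⊆ cutDarts A) :
    C.cost c ≤ weight c (cutEdges A) := by
  rw [cost_eq_weight]
  refine weight_mono hc ?_
  rintro _ ⟨m, rfl⟩
  exact ⟨_, hC ⟨m, rfl⟩, rfl⟩

lemma isFCutCycle_of_range_dart_eq_cutDarts_hull_union (hij : i ≤ j) (hCi : Ci.IsFCutCycle π i)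
    (hCj : Cj.IsFCutCycle π j)
    (hC : Set.range C.dart = cutDarts (hull (Ci.inside t ∪ Cj.inside t) s t)) :
    C.IsFCutCycle π j := by
  set U := Ci.inside t ∪ Cj.inside t
  have hs : s ∈ U := .inl (isCutCycle_iff.1 hCi.1)
  have ht : t ∉ U := not_or_intro notMem_inside_self notMem_inside_self
  have hpath {l : Fin (n + 1)} (hl : j < l) {v : G.Vertex} (hv : G.Incident v (π.f l)) : v ∉ U :=
    not_or_intro (hCi.notMem_inside (hij.trans_lt hl) hv) (hCj.notMem_inside hl hv)
  refine ⟨isCutCycle_of_cutDarts_subset mem_hull (notMem_hull hs ht) hC.ge, ?_, fun l hl hf => ?_⟩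
  · obtain ⟨u, hu, huf⟩ := hCj.1.exists_mem_component hCj.2.1
    have huhull : u ∈ hull U s t := component_subset_hull Set.subset_union_right ht hu
    obtain ⟨v, hv, hvf⟩ := π.exists_incident_mem (T := component Uᶜ t) mem_component_self j
      fun m hm d hd hdt => vertexOf_rev_mem_component hdt
        (hpath hm (hd ▸ incident_vertexOf_rev d))
    obtain ⟨d, hd, hdf⟩ := exists_mem_cutDarts_of_incident huf hvf huhull
      fun hvhull => hull_subset hs ht hvhull hv
    obtain ⟨m, rfl⟩ := hC.ge hd
    exact hdf ▸ faceOf_dart_mem_faces m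
  · obtain ⟨v, hv, hvf⟩ :=
      exists_incident_of_mem_faces (hC.trans_subset (cutDarts_hull_subset hs ht)) hf
    exact hpath hl hvf hv

lemma exists_isFCutCycle_of_range_dart_eq_cutDarts_hull_inter (hCi : Ci.IsFCutCycle π i)
    (hCj : Cj.IsCutCycle s t)
    (hC : Set.range C.dart = cutDarts (hull (Ci.inside t ∩ Cj.inside t) s t)) :
    ∃ i' ≤ i, C.IsFCutCycle π i' := by
  have hs : s ∈ Ci.inside t ∩ Cj.inside t := ⟨isCutCycle_iff.1 hCi.1, isCutCycle_iff.1 hCj⟩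
  have ht : t ∉ Ci.inside t ∩ Cj.inside t := fun h => notMem_inside_self h.1
  have hcut : C.IsCutCycle s t := isCutCycle_of_cutDarts_subset mem_hull (notMem_hull hs ht) hC.ge
  obtain ⟨i', hi'⟩ := hcut.exists_isFCutCycle π
  obtain ⟨v, hv, hvf⟩ :=
    exists_incident_of_mem_faces (hC.trans_subset (cutDarts_hull_subset hs ht)) hi'.2.1
  exact ⟨i', not_lt.1 fun hlt => hCi.notMem_inside hlt hvf hv.1, hi'⟩

lemma IsFCutCycle.exists_uncrossed (hc : ∀ e, 0 ≤ c e) (hij : i ≤ j) (hCi : Ci.IsFCutCycle π i)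
    (hCj : Cj.IsMinFCutCycle c π j) :
    ∃ i' ≤ i, ∃ C : G.DualCycle,
      C.IsFCutCycle π i' ∧ C.cells ⊆ Cj.interior t ∧ C.cost c ≤ Ci.cost c := by
  set A := Ci.inside t
  set B := Cj.inside t
  have hsA : s ∈ A := isCutCycle_iff.1 hCi.1
  have hsB : s ∈ B := isCutCycle_iff.1 hCj.1.1
  have hsU : s ∈ A ∪ B := .inl hsA
  have hsI : s ∈ A ∩ B := ⟨hsA, hsB⟩
  have htU : t ∉ A ∪ B := not_or_intro notMem_inside_self notMem_inside_self
  have htI : t ∉ A ∩ B := fun h => notMem_inside_self h.1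
  obtain ⟨K, hK⟩ := exists_dualCycle_range_dart_eq_cutDarts_hull hsU htU
  obtain ⟨C, hC⟩ := exists_dualCycle_range_dart_eq_cutDarts_hull hsI htI
  obtain ⟨i', hi', hCi'⟩ := exists_isFCutCycle_of_range_dart_eq_cutDarts_hull_inter hCi hCj.1.1 hC
  have hKcut := hK.trans_subset (cutDarts_hull_subset hsU htU)
  have hCcut := hC.trans_subset (cutDarts_hull_subset hsI htI)
  refine ⟨i', hi', C, hCi', cells_subset_interior fun m => (hCcut ⟨m, rfl⟩).1.2, ?_⟩
  have hminimal : Cj.cost c ≤ K.cost c :=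
    hCj.2 K (isFCutCycle_of_range_dart_eq_cutDarts_hull_union hij hCi hCj.1 hK)
  have huncross : K.cost c + C.cost c ≤ Ci.cost c + Cj.cost c :=
    calc K.cost c + C.cost c ≤ weight c (cutEdges (A ∪ B)) + weight c (cutEdges (A ∩ B)) :=
          add_le_add (cost_le_weight_cutEdges hc hKcut) (cost_le_weight_cutEdges hc hCcut)
      _ ≤ weight c (cutEdges A) + weight c (cutEdges B) :=
          weight_cutEdges_union_add_inter_le hc A B
      _ ≤ Ci.cost c + Cj.cost c := by
          rw [cost_eq_weight, cost_eq_weight]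
          exact add_le_add (weight_mono hc cutEdges_inside_subset)
            (weight_mono hc cutEdges_inside_subset)
  linarith

end Uncrossing

end DualCycle

end PlaneGraph

theorem mainTheorem7_general {D : Type*} [Finite D] (G : PlaneGraph D)
    (c : G.Edge → ℝ) (hc : ∀ e, 0 ≤ c e)
    (s t : G.Vertex) (n : ℕ) (π : G.DualPath s t n)
    (i j : Fin (n + 1)) (hij : i ≤ j)
    (Ci Cj : G.DualCycle)
    (hCi : Ci.IsFCutCycle π i) (hCj : Cj.IsMinFCutCycle c π j) :
    ∃ i' : Fin (n + 1), i' ≤ i ∧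
      ∃ C : G.DualCycle, C.IsMinFCutCycle c π i' ∧
        C.cells ⊆ Cj.interior t ∧ C.cost c ≤ Ci.cost c := by
  induction i using WellFoundedLT.induction generalizing Ci with | ind i ih
  obtain ⟨C', hC', hmin⟩ := hCi.exists_isMinFCutCycle c
  obtain ⟨i', hi', C, hC, hcells, hcost⟩ := hC'.exists_uncrossed hc hij hCj
  rcases hi'.eq_or_lt with rfl | hlt
  · exact ⟨i', le_rfl, C, ⟨hC, fun C'' hC'' => hcost.trans (hmin C'' hC'')⟩, hcells,
      hcost.trans (hmin Ci hCi)⟩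
  · obtain ⟨i'', hi'', C'', hC'', hcells', hcost'⟩ := ih i' hlt (hi'.trans hij) C hC
    exact ⟨i'', hi''.trans hi', C'', hC'', hcells', hcost'.trans (hcost.trans (hmin Ci hCi))⟩

theorem mainTheorem7 {D : Type*} [Finite D] (G : PlaneGraph D)
    (c : G.Edge → ℝ) (hc : ∀ e, 0 ≤ c e)
    (s t : G.Vertex) (n : ℕ) (π : G.DualPath s t n)
    (i j : Fin (n + 1)) (hij : i < j)
    (Ci Cj : G.DualCycle)
    (hCi : Ci.IsMinFCutCycle c π i) (hCj : Cj.IsMinFCutCycle c π j) :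
    ∃ i' : Fin (n + 1), i' ≤ i ∧
      ∃ C : G.DualCycle, C.IsMinFCutCycle c π i' ∧
        C.cells ⊆ Cj.interior t ∧ C.cost c ≤ Ci.cost c :=
  mainTheorem7_general G c hc s t n π i j hij.le Ci Cj hCi.1 hCj
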